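/- Let $G$ be a complex Hilbert space and let $T$ be a normal completely positive map on $\mathcal B(G)$ with Kraus decomposition $T(b)=\sum_{i\in I}L_i^*bL_i$ for all $b\in\mathcal B(G)$, where $I$ is an arbitrary index set, $L_i\in\mathcal B(G)$, and the sum converges unconditionally in the strong operator topology. Let $C\subset\mathcal B(G)$ be a maximal abelian von Neumann algebra, that is, a von Neumann algebra on $G$ which is a maximal commutative subalgebra of $\mathcal B(G)$. Then $T(C)\subset C$ if and only if for every $c\in C$ there exist coefficients $c_{ij}(c)\in C$ ($i,j\in I$) such that $(c_{ij}(c))_{i,j\in I}$ is the matrix of a bounded operator on $G\otimes\ell^2(I)$ (which is automatic when $I$ is finite) and such that, for all $c\in C$ and $i,j\in I$, $$c_{ij}(c^*)=c_{ji}(c)^*\qquad\text{and}\qquad cL_i-L_ic=\sum_{j\in I}c_{ij}(c)L_j ,$$ where the last sum converges unconditionally in the strong operator topology. -/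

import Mathlib

open scoped CStarAlgebra

namespace KrausMasa

variable {G : Type*} [NormedAddCommGroup G] [InnerProductSpace ℂ G] [CompleteSpace G]

/-- A map `T` on `B(G)` is normal if it preserves suprema (for the usual order of operators) of
nonempty upward directed sets of self-adjoint operators. -/
def IsNormalMap (T : (G →L[ℂ] G) → (G →L[ℂ] G)) : Prop :=
  ∀ (S : Set (G →L[ℂ] G)) (s : G →L[ℂ] G), S.Nonempty → (∀ a ∈ S, IsSelfAdjoint a) →
    DirectedOn (· ≤ ·) S → IsLUB S s → IsLUB (T '' S) (T s)

/-- The family `L` is a Kraus decomposition of `T`: for every `b`, the sum `∑ i, L i⋆ * b * L i`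
converges (unconditionally) to `T b` in the strong operator topology. -/
def IsKrausDecomposition {I : Type*} (T : (G →L[ℂ] G) → (G →L[ℂ] G))
    (L : I → (G →L[ℂ] G)) : Prop :=
  ∀ (b : G →L[ℂ] G) (g : G), HasSum (fun i => (star (L i) * b * L i) g) (T b g)

/-- A von Neumann algebra on `G` is maximal abelian if it is a maximal commutative subalgebra
of `B(G)`. -/
def IsMaximalAbelian (C : VonNeumannAlgebra G) : Prop :=
  Maximal (fun D : Subalgebra ℂ (G →L[ℂ] G) => ∀ a ∈ D, ∀ b ∈ D, a * b = b * a)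
    C.toStarSubalgebra.toSubalgebra

open scoped Classical in
/-- The matrix `m` of operators on `G` is the coefficient matrix of a bounded operator `A` on
`G ⊗ ℓ²(I)`, realized as the Hilbert sum of copies of `G`: the `i`-th component of
`A (g ⊗ e j)` is `m i j g`. -/
def IsBoundedMatrix {I : Type*} (m : I → I → (G →L[ℂ] G)) : Prop :=
  ∃ A : lp (fun _ : I => G) 2 →L[ℂ] lp (fun _ : I => G) 2,
    ∀ (i j : I) (g : G), A (lp.single 2 j g) i = m i j g

end KrausMasa

/-!
The Kraus family `L` is packaged into one bounded operator `V : G → ℓ²(I, G)`, `V g = (L i g)ᵢ`,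
so that `T b = V⋆ (b ⊗ 1) V` (`inner_krausMap_ampliation`). The commutation relations of the
theorem then say exactly that, for every `c ∈ C`, a bounded operator `A c` with entries in `C`
satisfies `A c⋆ = (A c)⋆` and `(c ⊗ 1) V - V c = A c V`.

Given such operators, `A d` commutes with `c ⊗ 1` because its entries commute with `c`, and both
`T c * d` and `d * T c` are equal to `V⋆ (c ⊗ 1) (d ⊗ 1 - A d) V`. Hence `T c` lies in the
commutant of `C`, which is `C` (`mem_of_commute_of_isMaximalAbelian`).

Conversely, suppose that `T` maps `C` into itself. On the span `K` of the vectors `(b ⊗ 1) V g`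
with `b ∈ C`, there is a right multiplication `ρ d : (b ⊗ 1) V g ↦ (b ⊗ 1) V (d g)`. It satisfies
`ρ(d)⋆ = ρ(d⋆)` since the inner products of the spanning vectors are
`⟪g, T (b⋆ * b') g'⟫` and `T (b⋆ * b')` commutes with `d` (`inner_krausSpan_rmul`). It is bounded
by `‖d‖`: writing `‖d‖² - d⋆ d = s⋆ s` with `s ∈ C`, one finds
`‖d‖² ‖x‖² - ‖ρ(d) x‖² = ‖ρ(s) x‖² ≥ 0` (`norm_krausSpan_rmul_le`). The operator equal to
`d ⊗ 1 - ρ d` on the closure of `K` and to `0` on its orthogonal complement is the required `A d`;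
it commutes with `C ⊗ 1`, so its entries lie in the commutant of `C`, which is `C`.
-/

open scoped InnerProductSpace ComplexOrder

namespace KrausMasa

/-! ### Operators determined by a subspace and its orthogonal complement -/

section Extension

variable {W H F : Type*} [AddCommGroup W] [Module ℂ W]
  [NormedAddCommGroup H] [InnerProductSpace ℂ H] [CompleteSpace H]
  [NormedAddCommGroup F] [NormedSpace ℂ F]

theorem ext_of_range_of_orthogonal (π : W →ₗ[ℂ] H) {A B : H →L[ℂ] F}
    (h₁ : ∀ w, A (π w) = B (π w)) (h₂ : ∀ x ∈ (LinearMap.range π)ᗮ, A x = B x) : A = B := by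
  set K := (LinearMap.range π).topologicalClosure
  have : CompleteSpace K := (LinearMap.range π).isClosed_topologicalClosure.completeSpace_coe
  have h₃ : ∀ x ∈ K, A x = B x := by
    have hcl : IsClosed {x | A x = B x} := isClosed_eq A.continuous B.continuous
    have hsub : ((LinearMap.range π : Submodule ℂ H) : Set H) ⊆ {x | A x = B x} := by
      rintro _ ⟨w, rfl⟩
      exact h₁ w
    exact fun x hx => closure_minimal hsub hcl hx
  ext x
  obtain ⟨y, hy, z, hz, rfl⟩ := K.exists_add_mem_mem_orthogonal x
  rw [Submodule.orthogonal_closure] at hz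
  rw [map_add, map_add, h₃ y hy, h₂ z hz]

/-- A linear map `Q` which is bounded for the seminorm `w ↦ ‖π w‖` is implemented by a bounded
operator on the closure of the range of `π`, extended by zero to the orthogonal complement. -/
theorem exists_clm_of_bounded (π : W →ₗ[ℂ] H) (Q : W →ₗ[ℂ] W) (M : ℝ)
    (hM : ∀ w, ‖π (Q w)‖ ≤ M * ‖π w‖) :
    ∃ A : H →L[ℂ] H, (∀ w, A (π w) = π (Q w)) ∧ ∀ x ∈ (LinearMap.range π)ᗮ, A x = 0 := by
  set K := (LinearMap.range π).topologicalClosure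
  have : CompleteSpace K := (LinearMap.range π).isClosed_topologicalClosure.completeSpace_coe
  have hmem : ∀ w, π w ∈ K := fun w =>
    (LinearMap.range π).le_topologicalClosure (LinearMap.mem_range_self π w)
  let e : W →ₗ[ℂ] K := π.codRestrict K hmem
  have he : DenseRange e := by
    intro y
    rw [closure_subtype]
    have : (Subtype.val '' Set.range e) = ((LinearMap.range π : Submodule ℂ H) : Set H) := by
      rw [← Set.range_comp]
      rfl
    rw [this]
    exact y.2
  let B : K →L[ℂ] H := (π ∘ₗ Q).extendOfNorm e
  have hB : ∀ w, B (e w) = π (Q w) := fun w =>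
    LinearMap.extendOfNorm_eq he ⟨M, fun x => hM x⟩ w
  refine ⟨B ∘L K.orthogonalProjectionOnto, fun w => ?_, fun x hx => ?_⟩
  · have : K.orthogonalProjectionOnto (π w) = e w :=
      Submodule.orthogonalProjectionOnto_mem_subspace_eq_self (K := K) (e w)
    rw [ContinuousLinearMap.comp_apply, this, hB]
  · rw [← Submodule.orthogonal_closure] at hx
    rw [ContinuousLinearMap.comp_apply,
      Submodule.orthogonalProjectionOnto_apply_of_mem_orthogonal hx, map_zero]

end Extension

/-! ### Ampliations and matrix entries of operators on `ℓ²(I, G)` -/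

theorem memℓp_two_iff {E I : Type*} [NormedAddCommGroup E] {f : I → E} :
    Memℓp f 2 ↔ Summable fun i => ‖f i‖ ^ 2 := by
  rw [memℓp_gen_iff (by norm_num)]
  simp

theorem lp_norm_sq {E I : Type*} [NormedAddCommGroup E] (x : lp (fun _ : I => E) 2) :
    ‖x‖ ^ 2 = ∑' i, ‖x i‖ ^ 2 := by
  have := lp.norm_rpow_eq_tsum (p := 2) (by norm_num) x
  simpa using this

open scoped Classical in
theorem ext_single {E I : Type*} [NormedAddCommGroup E] [NormedSpace ℂ E]
    {A B : lp (fun _ : I => E) 2 →L[ℂ] lp (fun _ : I => E) 2}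
    (h : ∀ (i j : I) (g : E), A (lp.single 2 j g) i = B (lp.single 2 j g) i) : A = B := by
  ext x : 1
  have hx : HasSum (fun j => lp.single 2 j (x j)) x := lp.hasSum_single (by norm_num) x
  refine (hx.mapL A).unique ?_
  convert! hx.mapL B using 2 with j
  ext i
  exact h i j _

theorem memℓp_ampliation {E I : Type*} [NormedAddCommGroup E] [NormedSpace ℂ E] (b : E →L[ℂ] E)
    (x : lp (fun _ : I => E) 2) :
    Memℓp (fun i => b (x i)) 2 := by
  rw [memℓp_two_iff]
  refine Summable.of_nonneg_of_le (fun i => by positivity) (fun i => ?_)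
    ((memℓp_two_iff.1 (lp.memℓp x)).mul_left (‖b‖ ^ 2))
  rw [← mul_pow]
  exact pow_le_pow_left₀ (norm_nonneg _) (b.le_opNorm _) 2

variable {G : Type*} [NormedAddCommGroup G] [InnerProductSpace ℂ G] {I : Type*}

/-- The ampliation `b ⊗ 1` of an operator `b` on `G` to `ℓ²(I, G)`, acting componentwise. -/
noncomputable def ampliation (b : G →L[ℂ] G) :
    lp (fun _ : I => G) 2 →L[ℂ] lp (fun _ : I => G) 2 :=
  LinearMap.mkContinuous
    { toFun := fun x => ⟨fun i => b (x i), memℓp_ampliation b x⟩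
      map_add' := fun x y => by ext i; exact map_add b (x i) (y i)
      map_smul' := fun r x => by ext i; simp } ‖b‖ (by
    intro x
    refine le_of_sq_le_sq ?_ (by positivity)
    rw [lp_norm_sq, mul_pow, lp_norm_sq, ← tsum_mul_left]
    refine Summable.tsum_le_tsum (fun i => ?_) (memℓp_two_iff.1 (memℓp_ampliation b x))
      ((memℓp_two_iff.1 (lp.memℓp x)).mul_left (‖b‖ ^ 2))
    rw [← mul_pow]
    exact pow_le_pow_left₀ (norm_nonneg _) (b.le_opNorm _) 2)

@[simp]
theorem ampliation_apply (b : G →L[ℂ] G) (x : lp (fun _ : I => G) 2) (i : I) :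
    ampliation b x i = b (x i) := rfl

theorem ampliation_mul_apply (b c : G →L[ℂ] G) (x : lp (fun _ : I => G) 2) :
    ampliation (b * c) x = ampliation b (ampliation c x) := rfl

open scoped Classical in
theorem ampliation_single (b : G →L[ℂ] G) (i : I) (g : G) :
    ampliation b (lp.single 2 i g) = lp.single 2 i (b g) := by
  ext j
  by_cases h : j = i
  · subst h; simp
  · simp [h]

variable [CompleteSpace G]

theorem inner_ampliation_left (b : G →L[ℂ] G) (x y : lp (fun _ : I => G) 2) :
    ⟪ampliation b x, y⟫_ℂ = ⟪x, ampliation (star b) y⟫_ℂ := by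
  rw [lp.inner_eq_tsum, lp.inner_eq_tsum]
  simp [ContinuousLinearMap.star_eq_adjoint, ContinuousLinearMap.adjoint_inner_right]

open scoped Classical in
/-- The matrix entry of an operator on `ℓ²(I, G)` in row `i` and column `j`. -/
noncomputable def entry (A : lp (fun _ : I => G) 2 →L[ℂ] lp (fun _ : I => G) 2) (i j : I) :
    G →L[ℂ] G :=
  ContinuousLinearMap.adjoint (lp.singleContinuousLinearMap ℂ (fun _ : I => G) 2 i) ∘L A ∘L
    lp.singleContinuousLinearMap ℂ (fun _ : I => G) 2 j

open scoped Classical in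
theorem entry_apply (A : lp (fun _ : I => G) 2 →L[ℂ] lp (fun _ : I => G) 2) (i j : I) (g : G) :
    entry A i j g = A (lp.single 2 j g) i := by
  refine ext_inner_left ℂ fun h => ?_
  simp only [entry, ContinuousLinearMap.comp_apply, ContinuousLinearMap.adjoint_inner_right,
    lp.singleContinuousLinearMap_apply, lp.inner_single_left]

theorem isBoundedMatrix_entry (A : lp (fun _ : I => G) 2 →L[ℂ] lp (fun _ : I => G) 2) :
    IsBoundedMatrix (entry A) :=
  ⟨A, fun i j g => (entry_apply A i j g).symm⟩

theorem entry_adjoint (A : lp (fun _ : I => G) 2 →L[ℂ] lp (fun _ : I => G) 2) (i j : I) :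
    entry (ContinuousLinearMap.adjoint A) i j = star (entry A j i) := by
  simp only [entry, ContinuousLinearMap.star_eq_adjoint, ContinuousLinearMap.adjoint_comp,
    ContinuousLinearMap.adjoint_adjoint, ContinuousLinearMap.comp_assoc]

theorem eq_of_entry_eq {A B : lp (fun _ : I => G) 2 →L[ℂ] lp (fun _ : I => G) 2}
    (h : ∀ i j, entry A i j = entry B i j) : A = B :=
  ext_single fun i j g => by rw [← entry_apply, ← entry_apply, h]

theorem entry_ampliation_comp (b : G →L[ℂ] G)
    (A : lp (fun _ : I => G) 2 →L[ℂ] lp (fun _ : I => G) 2) (i j : I) :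
    entry (ampliation b ∘L A) i j = b * entry A i j := by
  ext g
  simp [entry_apply]

theorem entry_comp_ampliation (b : G →L[ℂ] G)
    (A : lp (fun _ : I => G) 2 →L[ℂ] lp (fun _ : I => G) 2) (i j : I) :
    entry (A ∘L ampliation b) i j = entry A i j * b := by
  ext g
  simp [entry_apply, ampliation_single]

open scoped Classical in
/-- The rows of the matrix of a bounded operator may be applied to any vector of `ℓ²(I, G)`. -/
theorem hasSum_entry_apply (A : lp (fun _ : I => G) 2 →L[ℂ] lp (fun _ : I => G) 2)
    (x : lp (fun _ : I => G) 2) (i : I) : HasSum (fun j => entry A i j (x j)) (A x i) := by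
  have hx : HasSum (fun j => lp.single 2 j (x j)) x := lp.hasSum_single (by norm_num) x
  have := hx.mapL (ContinuousLinearMap.adjoint
    (lp.singleContinuousLinearMap ℂ (fun _ : I => G) 2 i) ∘L A)
  convert! this using 1
  refine ext_inner_left ℂ fun h => ?_
  simp only [ContinuousLinearMap.comp_apply, ContinuousLinearMap.adjoint_inner_right,
    lp.singleContinuousLinearMap_apply, lp.inner_single_left]

/-! ### The dilation attached to a Kraus decomposition -/

section Kraus

variable {T : (G →L[ℂ] G) → (G →L[ℂ] G)} {L : I → (G →L[ℂ] G)}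

theorem IsKrausDecomposition.hasSum_inner (hL : IsKrausDecomposition T L) (b : G →L[ℂ] G)
    (g h : G) : HasSum (fun i => ⟪L i g, b (L i h)⟫_ℂ) ⟪g, T b h⟫_ℂ := by
  have := (hL b h).mapL (innerSL ℂ g)
  simpa [ContinuousLinearMap.star_eq_adjoint, ContinuousLinearMap.adjoint_inner_right] using this

theorem IsKrausDecomposition.hasSum_norm_sq (hL : IsKrausDecomposition T L) (g : G) :
    HasSum (fun i => ‖L i g‖ ^ 2) (RCLike.re ⟪g, T 1 g⟫_ℂ) := by
  have := (hL.hasSum_inner 1 g g).mapL (RCLike.reCLM (K := ℂ))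
  simp only [one_apply_eq_self, RCLike.reCLM_apply, ← norm_sq_eq_re_inner] at this
  exact this

/-- The operator `g ↦ (L i g)ᵢ` from `G` to `ℓ²(I, G)` attached to a Kraus decomposition. -/
noncomputable def krausMap (hL : IsKrausDecomposition T L) : G →L[ℂ] lp (fun _ : I => G) 2 :=
  LinearMap.mkContinuous
    { toFun := fun g => ⟨fun i => L i g, memℓp_two_iff.2 (hL.hasSum_norm_sq g).summable⟩
      map_add' := fun x y => by ext i; exact map_add (L i) x y
      map_smul' := fun r x => by ext i; simp } (√‖T 1‖) (by
    intro g
    refine le_of_sq_le_sq ?_ (by positivity)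
    rw [lp_norm_sq, mul_pow, Real.sq_sqrt (norm_nonneg _)]
    refine (hL.hasSum_norm_sq g).tsum_eq.trans_le ?_
    calc RCLike.re ⟪g, T 1 g⟫_ℂ ≤ ‖g‖ * ‖T 1 g‖ := re_inner_le_norm _ _
      _ ≤ ‖g‖ * (‖T 1‖ * ‖g‖) := by gcongr; exact (T 1).le_opNorm g
      _ = ‖T 1‖ * ‖g‖ ^ 2 := by ring)

/-- The dilation identity `T b = V⋆ (b ⊗ 1) V`. -/
theorem inner_krausMap_ampliation (hL : IsKrausDecomposition T L) (b : G →L[ℂ] G) (g h : G) :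
    ⟪krausMap hL g, ampliation b (krausMap hL h)⟫_ℂ = ⟪g, T b h⟫_ℂ :=
  (lp.hasSum_inner _ _).unique (hL.hasSum_inner b g h)

theorem inner_ampliation_krausMap (hL : IsKrausDecomposition T L) (a b : G →L[ℂ] G) (g h : G) :
    ⟪ampliation a (krausMap hL g), ampliation b (krausMap hL h)⟫_ℂ = ⟪g, T (star a * b) h⟫_ℂ := by
  rw [inner_ampliation_left, ← ampliation_mul_apply, inner_krausMap_ampliation]

/-! ### Maximal abelian von Neumann algebras -/

theorem commute_of_isMaximalAbelian {C : VonNeumannAlgebra G} (hC : IsMaximalAbelian C)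
    {a b : G →L[ℂ] G} (ha : a ∈ C) (hb : b ∈ C) : a * b = b * a :=
  hC.prop a ha b hb

/-- A maximal commutative subalgebra is its own commutant: adjoining an element of the commutant
gives a commutative subalgebra again. -/
theorem mem_of_commute_of_isMaximalAbelian {C : VonNeumannAlgebra G} (hC : IsMaximalAbelian C)
    {x : G →L[ℂ] G} (hx : ∀ c ∈ C, c * x = x * c) : x ∈ C := by
  set s : Set (G →L[ℂ] G) := insert x (C : Set (G →L[ℂ] G))
  have hcomm : ∀ a ∈ s, ∀ b ∈ s, a * b = b * a := by
    rintro a (rfl | ha) b (rfl | hb)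
    · rfl
    · exact (hx b hb).symm
    · exact hx a ha
    · exact commute_of_isMaximalAbelian hC ha hb
  have := Algebra.isMulCommutative_adjoin ℂ hcomm
  have hle := hC.le_of_ge (y := Algebra.adjoin ℂ s)
    (fun a ha b hb => setLike_mul_comm ha hb)
    (fun c hc => Algebra.subset_adjoin (Set.mem_insert_of_mem _ hc))
  exact hle (Algebra.subset_adjoin (Set.mem_insert _ _))

/-- In a maximal abelian von Neumann algebra, `‖d‖² - d⋆ d` has the form `s⋆ s`. -/
theorem exists_star_mul_self_eq {C : VonNeumannAlgebra G} (hC : IsMaximalAbelian C)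
    {d : G →L[ℂ] G} (hd : d ∈ C) :
    ∃ s ∈ C, star s * s = algebraMap ℝ (G →L[ℂ] G) (‖d‖ ^ 2) - star d * d := by
  set a := algebraMap ℝ (G →L[ℂ] G) (‖d‖ ^ 2) - star d * d
  have hnonneg : 0 ≤ a := sub_nonneg.2 CStarAlgebra.star_mul_le_algebraMap_norm_sq
  refine ⟨CFC.sqrt a, mem_of_commute_of_isMaximalAbelian hC fun c hc => ?_, ?_⟩
  · have h : Commute a c := by
      refine Commute.sub_left (Algebra.commutes _ _) ?_
      exact commute_of_isMaximalAbelian hC (mul_mem (star_mem hd) hd) hc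
    exact (h.cfcₙ_nnreal NNReal.sqrt).symm
  · rw [(CFC.sqrt_nonneg a).isSelfAdjoint.star_eq, CFC.sqrt_mul_sqrt_self a hnonneg]

/-! ### Right multiplication on the span of the dilated vectors -/

/-- Formal sums of vectors `(b ⊗ 1) V g` with `b ∈ C`, mapped to `ℓ²(I, G)`. -/
noncomputable def krausSpan (hL : IsKrausDecomposition T L) (C : VonNeumannAlgebra G) :
    (C →₀ G) →ₗ[ℂ] lp (fun _ : I => G) 2 :=
  Finsupp.lsum ℂ fun b => (ampliation (b : G →L[ℂ] G) ∘L krausMap hL).toLinearMap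

@[simp]
theorem krausSpan_single (hL : IsKrausDecomposition T L) (C : VonNeumannAlgebra G) (b : C) (g : G) :
    krausSpan hL C (Finsupp.single b g) = ampliation (b : G →L[ℂ] G) (krausMap hL g) := by
  simp [krausSpan]

/-- The formal left multiplication `(b ⊗ 1) V g ↦ (d * b ⊗ 1) V g`. -/
noncomputable def lmul (C : VonNeumannAlgebra G) (d : C) : (C →₀ G) →ₗ[ℂ] (C →₀ G) :=
  Finsupp.lmapDomain G ℂ (d * ·)

/-- The formal right multiplication `(b ⊗ 1) V g ↦ (b ⊗ 1) V (d g)`. -/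
noncomputable def rmul (C : VonNeumannAlgebra G) (d : G →L[ℂ] G) : (C →₀ G) →ₗ[ℂ] (C →₀ G) :=
  Finsupp.mapRange.linearMap d.toLinearMap

@[simp]
theorem lmul_single (C : VonNeumannAlgebra G) (d b : C) (g : G) :
    lmul C d (Finsupp.single b g) = Finsupp.single (d * b) g := by
  simp [lmul]

@[simp]
theorem rmul_single (C : VonNeumannAlgebra G) (d : G →L[ℂ] G) (b : C) (g : G) :
    rmul C d (Finsupp.single b g) = Finsupp.single b (d g) := by
  simp [rmul]

theorem krausSpan_lmul (hL : IsKrausDecomposition T L) (C : VonNeumannAlgebra G) (d : C)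
    (w : C →₀ G) : krausSpan hL C (lmul C d w) = ampliation (d : G →L[ℂ] G) (krausSpan hL C w) := by
  induction w using Finsupp.induction_linear with
  | zero => simp
  | add v w hv hw => simp only [map_add, hv, hw]
  | single b g => rw [lmul_single, krausSpan_single, krausSpan_single, ← ampliation_mul_apply]; rfl

theorem rmul_lmul (C : VonNeumannAlgebra G) (d : G →L[ℂ] G) (c : C) (w : C →₀ G) :
    rmul C d (lmul C c w) = lmul C c (rmul C d w) := by
  induction w using Finsupp.induction_linear with
  | zero => simp
  | add v w hv hw => simp only [map_add, hv, hw]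
  | single b g => simp

theorem rmul_mul (C : VonNeumannAlgebra G) (d e : G →L[ℂ] G) (w : C →₀ G) :
    rmul C (d * e) w = rmul C d (rmul C e w) := by
  ext b
  simp [rmul]

theorem lmul_lmul_comm {C : VonNeumannAlgebra G} (hC : IsMaximalAbelian C) (c d : C) (w : C →₀ G) :
    lmul C c (lmul C d w) = lmul C d (lmul C c w) := by
  induction w using Finsupp.induction_linear with
  | zero => simp
  | add v w hv hw => simp only [map_add, hv, hw]
  | single b g =>
    have : c * d = d * c := Subtype.ext (commute_of_isMaximalAbelian hC c.2 d.2)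
    simp [← mul_assoc, this]

/-- Right multiplication is a `⋆`-representation of `C` when `T` leaves `C` invariant. -/
theorem inner_krausSpan_rmul (hL : IsKrausDecomposition T L) {C : VonNeumannAlgebra G}
    (hC : IsMaximalAbelian C) (hT : ∀ c ∈ C, T c ∈ C) {d : G →L[ℂ] G} (hd : d ∈ C)
    (v w : C →₀ G) :
    ⟪krausSpan hL C (rmul C d v), krausSpan hL C w⟫_ℂ =
      ⟪krausSpan hL C v, krausSpan hL C (rmul C (star d) w)⟫_ℂ := by
  induction v using Finsupp.induction_linear with
  | zero => simp
  | add v v' hv hv' => simp only [map_add, inner_add_left, hv, hv']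
  | single b g =>
    induction w using Finsupp.induction_linear with
    | zero => simp
    | add w w' hw hw' => simp only [map_add, inner_add_right, hw, hw']
    | single b' h =>
      simp only [rmul_single, krausSpan_single, inner_ampliation_krausMap]
      have hTC : T (star (b : G →L[ℂ] G) * b') ∈ C := hT _ (mul_mem (star_mem b.2) b'.2)
      have hcomm := commute_of_isMaximalAbelian hC (star_mem hd) hTC
      rw [← mul_apply_eq_comp, ← hcomm, mul_apply_eq_comp,
        ContinuousLinearMap.star_eq_adjoint d, ContinuousLinearMap.adjoint_inner_right]

theorem inner_krausSpan_rmul_rmul (hL : IsKrausDecomposition T L) {C : VonNeumannAlgebra G}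
    (hC : IsMaximalAbelian C) (hT : ∀ c ∈ C, T c ∈ C) {d : G →L[ℂ] G} (hd : d ∈ C)
    (w : C →₀ G) :
    ⟪krausSpan hL C (rmul C d w), krausSpan hL C (rmul C d w)⟫_ℂ =
      ⟪krausSpan hL C w, krausSpan hL C (rmul C (star d * d) w)⟫_ℂ := by
  rw [inner_krausSpan_rmul hL hC hT hd, rmul_mul]

/-- The bound is the positivity of `⟪x, ρ(‖d‖² - d⋆ d) x⟫ = ‖ρ(s) x‖²` for `x = krausSpan hL C w`,
where `ρ` is right multiplication and `s⋆ s = ‖d‖² - d⋆ d`. -/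
theorem norm_krausSpan_rmul_le (hL : IsKrausDecomposition T L) {C : VonNeumannAlgebra G}
    (hC : IsMaximalAbelian C) (hT : ∀ c ∈ C, T c ∈ C) {d : G →L[ℂ] G} (hd : d ∈ C)
    (w : C →₀ G) : ‖krausSpan hL C (rmul C d w)‖ ≤ ‖d‖ * ‖krausSpan hL C w‖ := by
  obtain ⟨s, hs, hsd⟩ := exists_star_mul_self_eq hC hd
  have hsplit : rmul C (star s * s) w = ((‖d‖ ^ 2 : ℝ) : ℂ) • w - rmul C (star d * d) w := by
    rw [hsd]
    ext b
    simp [rmul, Algebra.algebraMap_eq_smul_one, ← Complex.coe_smul]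
  have key := inner_krausSpan_rmul_rmul hL hC hT hs w
  rw [hsplit, map_sub, map_smul, inner_sub_right, inner_smul_right,
    ← inner_krausSpan_rmul_rmul hL hC hT hd] at key
  have hre := congrArg Complex.re key
  simp only [inner_self_eq_norm_sq_to_K, Complex.coe_algebraMap, ← Complex.ofReal_pow,
    ← Complex.ofReal_mul, ← Complex.ofReal_sub, Complex.ofReal_re] at hre
  refine le_of_sq_le_sq ?_ (by positivity)
  rw [mul_pow]
  nlinarith [sq_nonneg ‖krausSpan hL C (rmul C s w)‖]

/-! ### The two implications -/

/-- The bounded operators whose matrix entries are the coefficients of the commutation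
relations. -/
theorem exists_coefficient_operator (hL : IsKrausDecomposition T L) {C : VonNeumannAlgebra G}
    (hC : IsMaximalAbelian C) (hT : ∀ c ∈ C, T c ∈ C) :
    ∃ A : C → (lp (fun _ : I => G) 2 →L[ℂ] lp (fun _ : I => G) 2),
      (∀ d, A (star d) = ContinuousLinearMap.adjoint (A d)) ∧
      (∀ d c : C, ampliation (c : G →L[ℂ] G) ∘L A d = A d ∘L ampliation (c : G →L[ℂ] G)) ∧
      ∀ (d : C) (g : G), A d (krausMap hL g) =
        ampliation (d : G →L[ℂ] G) (krausMap hL g) - krausMap hL ((d : G →L[ℂ] G) g) := by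
  set π := krausSpan hL C with hπ
  have hQ (d : C) : ∃ A : lp (fun _ : I => G) 2 →L[ℂ] lp (fun _ : I => G) 2,
      (∀ w, A (π w) = π ((lmul C d - rmul C d) w)) ∧ ∀ x ∈ (LinearMap.range π)ᗮ, A x = 0 := by
    refine exists_clm_of_bounded π _ (‖ampliation (I := I) (d : G →L[ℂ] G)‖ + ‖(d : G →L[ℂ] G)‖)
      fun w => ?_
    rw [LinearMap.sub_apply, map_sub, krausSpan_lmul, add_mul]
    refine (norm_sub_le _ _).trans (add_le_add (ContinuousLinearMap.le_opNorm _ _) ?_)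
    exact norm_krausSpan_rmul_le hL hC hT d.2 w
  choose A hA hA' using hQ
  have horth : ∀ x ∈ (LinearMap.range π)ᗮ, ∀ w, ⟪π w, x⟫_ℂ = 0 := fun x hx w =>
    (Submodule.mem_orthogonal _ x).1 hx _ (LinearMap.mem_range_self π w)
  -- In each argument, adjointness is checked on `range π` and on its orthogonal complement.
  have hadj : ∀ (d : C) w x, ⟪A d (π w), x⟫_ℂ = ⟪π w, A (star d) x⟫_ℂ := by
    intro d w
    have : innerSL ℂ (A d (π w)) = innerSL ℂ (π w) ∘L A (star d) := by
      refine ext_of_range_of_orthogonal π (fun v => ?_) (fun x hx => ?_)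
      · rw [ContinuousLinearMap.comp_apply, innerSL_apply_apply, innerSL_apply_apply, hA, hA,
          LinearMap.sub_apply, LinearMap.sub_apply, map_sub π, map_sub π, inner_sub_left,
          inner_sub_right, hπ, krausSpan_lmul, krausSpan_lmul, inner_ampliation_left,
          inner_krausSpan_rmul hL hC hT d.2]
        rfl
      · rw [ContinuousLinearMap.comp_apply, innerSL_apply_apply, innerSL_apply_apply, hA,
          hA' _ x hx, inner_zero_right, horth x hx]
    exact fun x => congr($this x)
  refine ⟨A, fun d => ?_, fun d c => ?_, fun d g => ?_⟩
  · refine ext_of_range_of_orthogonal π (fun w => ?_) (fun x hx => ?_)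
    · refine ext_inner_right ℂ fun x => ?_
      rw [ContinuousLinearMap.adjoint_inner_left, hadj, star_star]
    · have : innerSL ℂ x ∘L A d = 0 := by
        refine ext_of_range_of_orthogonal π (fun v => ?_) (fun y hy => ?_)
        · rw [ContinuousLinearMap.comp_apply, innerSL_apply_apply, hA,
            inner_eq_zero_symm.1 (horth x hx _)]
          rfl
        · rw [ContinuousLinearMap.comp_apply, hA' d y hy, map_zero]
          rfl
      refine ext_inner_right ℂ fun y => ?_
      rw [ContinuousLinearMap.adjoint_inner_left, hA' _ x hx, inner_zero_left]
      exact congr($this y).symm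
  · refine ext_of_range_of_orthogonal π (fun w => ?_) (fun x hx => ?_)
    · simp only [ContinuousLinearMap.comp_apply, hA]
      rw [hπ, ← krausSpan_lmul, ← krausSpan_lmul, ← hπ, hA]
      simp only [LinearMap.sub_apply, map_sub, rmul_lmul, lmul_lmul_comm hC]
    -- `C ⊗ 1` is closed under adjoints, so it leaves the orthogonal complement invariant too.
    · have hcx : ampliation (c : G →L[ℂ] G) x ∈ (LinearMap.range π)ᗮ := by
        rw [Submodule.mem_orthogonal]
        rintro _ ⟨w, rfl⟩
        have h := inner_ampliation_left (star (c : G →L[ℂ] G)) (π w) x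
        rw [star_star] at h
        rw [← h, ← horth x hx (lmul C (star c) w), hπ, krausSpan_lmul]
        rfl
      simp only [ContinuousLinearMap.comp_apply, hA' _ _ hcx, hA' _ _ hx, map_zero]
  -- `V g` is the spanning vector with `b = 1`.
  · have h := hA d (Finsupp.single 1 g)
    rw [LinearMap.sub_apply, map_sub, krausSpan_lmul, rmul_single, hπ, krausSpan_single,
      krausSpan_single] at h
    exact h

/-- The commutation relations place `T c` in the commutant of `C`. -/
theorem commute_of_coefficient_operator (hL : IsKrausDecomposition T L) {c d : G →L[ℂ] G}
    {A : lp (fun _ : I => G) 2 →L[ℂ] lp (fun _ : I => G) 2}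
    (hcA : ampliation c ∘L A = A ∘L ampliation c) (hcd : c * d = d * c)
    (hA : ∀ g, A (krausMap hL g) = ampliation d (krausMap hL g) - krausMap hL (d g))
    (hA' : ∀ g, ContinuousLinearMap.adjoint A (krausMap hL g) =
      ampliation (star d) (krausMap hL g) - krausMap hL (star d g)) :
    d * T c = T c * d := by
  ext g
  refine ext_inner_left ℂ fun h => ?_
  have h₁ : krausMap hL (d g) = ampliation d (krausMap hL g) - A (krausMap hL g) := by
    rw [hA]; abel
  have h₂ : krausMap hL (star d h) =
      ampliation (star d) (krausMap hL h) - ContinuousLinearMap.adjoint A (krausMap hL h) := by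
    rw [hA']; abel
  have h₃ : ampliation c (A (krausMap hL g)) = A (ampliation c (krausMap hL g)) :=
    congr($hcA (krausMap hL g))
  rw [mul_apply_eq_comp, mul_apply_eq_comp,
    ← ContinuousLinearMap.adjoint_inner_left, ← ContinuousLinearMap.star_eq_adjoint,
    ← inner_krausMap_ampliation hL, ← inner_krausMap_ampliation hL, h₁, h₂, map_sub,
    inner_sub_left, inner_sub_right, inner_ampliation_left, star_star, h₃,
    ContinuousLinearMap.adjoint_inner_left, ← ampliation_mul_apply, ← ampliation_mul_apply, hcd]

end Kraus

end KrausMasa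

open KrausMasa in
theorem corollary3p4 {G : Type*} [NormedAddCommGroup G] [InnerProductSpace ℂ G] [CompleteSpace G]
    {I : Type*} (T : (G →L[ℂ] G) →CP (G →L[ℂ] G)) (hT : KrausMasa.IsNormalMap T)
    (L : I → (G →L[ℂ] G)) (hL : KrausMasa.IsKrausDecomposition T L)
    (C : VonNeumannAlgebra G) (hC : KrausMasa.IsMaximalAbelian C) :
    (∀ c ∈ C, T c ∈ C) ↔
      ∃ γ : C → I → I → C,
        (∀ c : C, KrausMasa.IsBoundedMatrix (fun i j => (γ c i j : G →L[ℂ] G))) ∧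
        (∀ (c : C) (i j : I), γ (star c) i j = star (γ c j i)) ∧
        (∀ (c : C) (i : I) (g : G),
          HasSum (fun j => ((γ c i j : G →L[ℂ] G) * L j) g)
            (((c : G →L[ℂ] G) * L i - L i * (c : G →L[ℂ] G)) g)) := by
  constructor
  · intro h
    obtain ⟨A, hstar, hcomm, hA⟩ := exists_coefficient_operator hL hC h
    have hmem : ∀ (c : C) (i j : I), entry (A c) i j ∈ C := fun c i j =>
      mem_of_commute_of_isMaximalAbelian hC fun a ha => by
        rw [← entry_ampliation_comp, ← entry_comp_ampliation, hcomm c ⟨a, ha⟩]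
    refine ⟨fun c i j => ⟨entry (A c) i j, hmem c i j⟩, fun c => isBoundedMatrix_entry (A c),
      fun c i j => Subtype.ext ?_, fun c i g => ?_⟩
    · exact (congrArg (fun B => entry B i j) (hstar c)).trans (entry_adjoint (A c) i j)
    · have := hasSum_entry_apply (A c) (krausMap hL g) i
      rw [hA] at this
      exact this
  · rintro ⟨γ, hbdd, hstar, hsum⟩ c hc
    choose A hA using hbdd
    have hentry : ∀ c i j, entry (A c) i j = γ c i j := fun c i j => by
      ext g
      rw [entry_apply, hA]
    have hrel : ∀ (d : C) (g : G), A d (krausMap hL g) =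
        ampliation (d : G →L[ℂ] G) (krausMap hL g) - krausMap hL ((d : G →L[ℂ] G) g) := by
      intro d g
      ext i
      have h := hasSum_entry_apply (A d) (krausMap hL g) i
      simp only [hentry] at h
      exact h.unique (hsum d i g)
    have hadj : ∀ d, A (star d) = ContinuousLinearMap.adjoint (A d) := fun d =>
      eq_of_entry_eq fun i j => by
        rw [entry_adjoint, hentry, hentry, hstar]
        rfl
    refine mem_of_commute_of_isMaximalAbelian hC fun d hd => ?_
    refine commute_of_coefficient_operator hL (A := A ⟨d, hd⟩) ?_
      (commute_of_isMaximalAbelian hC hc hd) (hrel ⟨d, hd⟩) fun g => ?_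
    · refine eq_of_entry_eq fun i j => ?_
      rw [entry_ampliation_comp, entry_comp_ampliation, hentry]
      exact commute_of_isMaximalAbelian hC hc (γ _ i j).2
    · rw [← hadj]
      exact hrel (star ⟨d, hd⟩) g
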